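/- All matrices are real. Let $FW_3^4$ be the cone of positive semidefinite (psd) $4\times 4$ matrices of factor width at most $3$, that is, of psd matrices of the form $A=VV^T$ where $V$ is a rectangular matrix each of whose columns has at most $3$ nonzero entries, and let $$(FW_3^4)^*=\{Y\in\mathbb{R}^{4\times 4} : Y=Y^T,\ \operatorname{trace}(YX^T)\ge 0 \text{ for all } X\in FW_3^4\}$$ be its dual cone. A matrix $B\neq 0$ spans an extreme ray of $(FW_3^4)^*$ if the ray $\{tB : t\ge 0\}$ is contained in $(FW_3^4)^*$ and, whenever a point of the ray lies in the open segment between two elements of $(FW_3^4)^*$, both of these elements lie on the ray. Let $B$ be a symmetric $4\times 4$ matrix that is not psd and spans an extreme ray of $(FW_3^4)^*$. Then there exist $a,c\in(-\pi,\pi)\setminus\{0\}$, a permutation matrix $P$ and a nonsingular diagonal matrix $D$ such that $$DPBP^TD=\begin{bmatrix} 1&\cos(a)&\cos(a-c)&\cos(c)\\ \cos(a)&1&\cos(c)&\cos(a-c)\\ \cos(a-c)&\cos(c)&1&\cos(a)\\ \cos(c)&\cos(a-c)&\cos(a)&1 \end{bmatrix}.$$ -/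

import Mathlib

/-- The cone of real positive semidefinite `n × n` matrices of factor width at most `k`, i.e.
those that can be written as `V * Vᵀ` with a real rectangular matrix `V` each of whose columns
has at most `k` nonzero entries. -/
def FW (n k : ℕ) : Set (Matrix (Fin n) (Fin n) ℝ) :=
  {A | A.PosSemidef ∧ ∃ (m : ℕ) (V : Matrix (Fin n) (Fin m) ℝ),
    A = V * V.transpose ∧ ∀ j : Fin m, {i : Fin n | V i j ≠ 0}.ncard ≤ k}

/-- The dual cone, inside the space of real symmetric matrices and with respect to the Frobenius
inner product `trace (Y * Xᵀ)`, of a set `K` of real matrices. -/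
def dualCone {n : ℕ} (K : Set (Matrix (Fin n) (Fin n) ℝ)) : Set (Matrix (Fin n) (Fin n) ℝ) :=
  {Y | Y.IsSymm ∧ ∀ X ∈ K, 0 ≤ (Y * X.transpose).trace}

/-- `A` spans an extreme ray of `K`: `A` is nonzero and the ray `{t • A | t ≥ 0}` is an extreme
subset (a face) of `K`. -/
def SpansExtremeRay {n : ℕ} (K : Set (Matrix (Fin n) (Fin n) ℝ))
    (A : Matrix (Fin n) (Fin n) ℝ) : Prop :=
  A ≠ 0 ∧ IsExtreme ℝ K {X | ∃ t : ℝ, 0 ≤ t ∧ X = t • A}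

open Matrix

theorem mem_dualCone_FW_four_three_iff (Y : Matrix (Fin 4) (Fin 4) ℝ) :
    Y ∈ dualCone (FW 4 3) ↔
      Y.IsSymm ∧ ∀ v : Fin 4 → ℝ, (∃ i, v i = 0) → 0 ≤ v ⬝ᵥ Y *ᵥ v := by
  constructor
  · rintro ⟨hs, h⟩
    refine ⟨hs, fun v ⟨i, hi⟩ => ?_⟩
    have hX : vecMulVec v v ∈ FW 4 3 := by
      refine ⟨by simpa using posSemidef_vecMulVec_self_star v, 1, of fun i _ => v i, ?_, ?_⟩
      · ext a b
        rw [mul_apply]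
        simp [vecMulVec_apply]
      · intro _
        have hsub : {k : Fin 4 | v k ≠ 0} ⊆ {i}ᶜ := by
          intro k hk hki
          exact hk (hki ▸ hi)
        refine (Set.ncard_le_ncard hsub (Set.toFinite _)).trans ?_
        rw [Set.ncard_compl]
        simp
    have := h _ hX
    rwa [transpose_vecMulVec, mul_vecMulVec, trace_vecMulVec, dotProduct_comm] at this
  · rintro ⟨hs, h⟩
    refine ⟨hs, ?_⟩
    rintro X ⟨-, m, V, rfl, hV⟩
    have key : (Y * (V * Vᵀ)ᵀ).trace = ∑ j, (fun i => V i j) ⬝ᵥ Y *ᵥ (fun i => V i j) := by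
      rw [transpose_mul, transpose_transpose, ← Matrix.mul_assoc, trace_mul_comm,
        trace]
      refine Finset.sum_congr rfl fun j _ => ?_
      simp [diag, mul_apply, dotProduct, mulVec]
    rw [key]
    refine Finset.sum_nonneg fun j _ => h _ ?_
    by_contra! hne
    have : {i : Fin 4 | V i j ≠ 0} = Set.univ := Set.eq_univ_of_forall hne
    have h3 := hV j
    rw [this, Set.ncard_univ] at h3
    simp at h3

theorem SpansExtremeRay.exists_eq_smul {n : ℕ} {K : Set (Matrix (Fin n) (Fin n) ℝ)}
    {B E : Matrix (Fin n) (Fin n) ℝ} (h : SpansExtremeRay K B) (h₁ : B + E ∈ K)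
    (h₂ : B - E ∈ K) : ∃ s : ℝ, E = s • B := by
  have hmem := h.2.2 h₁ h₂ (show B ∈ {X | ∃ t : ℝ, 0 ≤ t ∧ X = t • B} from ⟨1, by simp⟩)
    ⟨1 / 2, 1 / 2, by norm_num, by norm_num, by norm_num, by
      rw [← smul_add, add_add_sub_cancel, smul_add, ← add_smul]; norm_num⟩
  obtain ⟨t, -, ht⟩ := hmem
  exact ⟨t - 1, by rw [sub_smul, one_smul, ← ht]; abel⟩

theorem Matrix.IsSymm.dotProduct_mulVec_comm {n : Type*} [Fintype n] {M : Matrix n n ℝ}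
    (hM : M.IsSymm) (v w : n → ℝ) : v ⬝ᵥ M *ᵥ w = w ⬝ᵥ M *ᵥ v := by
  rw [dotProduct_mulVec, ← mulVec_transpose, hM, dotProduct_comm]

/-- A vector orthogonal to the kernel of a symmetric matrix lies in its range. -/
theorem Matrix.IsSymm.exists_mulVec_eq {n : Type*} [Fintype n] [DecidableEq n]
    {M : Matrix n n ℝ} (hM : M.IsSymm) {u : n → ℝ}
    (hu : ∀ w, M *ᵥ w = 0 → u ⬝ᵥ w = 0) : ∃ y, M *ᵥ y = u := by
  by_contra hne
  obtain ⟨f, hfu, hf⟩ := Submodule.exists_le_ker_of_notMem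
    (p := LinearMap.range M.mulVecLin) (v := u) (fun ⟨y, hy⟩ => hne ⟨y, hy⟩)
  obtain ⟨w, rfl⟩ := (dotProductEquiv ℝ n).surjective f
  apply hfu
  simp only [dotProductEquiv_apply_apply]
  rw [dotProduct_comm]
  apply hu
  refine dotProduct_eq_zero _ fun y => ?_
  have := hf ⟨y, rfl⟩
  simp only [LinearMap.mem_ker, dotProductEquiv_apply_apply, mulVecLin_apply] at this
  rw [dotProduct_comm, hM.dotProduct_mulVec_comm, this]

/-- Cauchy–Schwarz for a positive semidefinite quadratic form. -/
theorem Matrix.IsSymm.sq_dotProduct_mulVec_le {n : Type*} [Fintype n]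
    {M : Matrix n n ℝ} (hM : M.IsSymm) (hpos : ∀ v, 0 ≤ v ⬝ᵥ M *ᵥ v) (v w : n → ℝ) :
    (v ⬝ᵥ M *ᵥ w) ^ 2 ≤ (v ⬝ᵥ M *ᵥ v) * (w ⬝ᵥ M *ᵥ w) := by
  have h : ∀ x : ℝ, 0 ≤ (v ⬝ᵥ M *ᵥ v) * (x * x) + (2 * (v ⬝ᵥ M *ᵥ w)) * x + w ⬝ᵥ M *ᵥ w := by
    intro x
    have := hpos (x • v + w)
    simp only [mulVec_add, mulVec_smul, dotProduct_add, add_dotProduct, dotProduct_smul,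
      smul_dotProduct, smul_eq_mul, hM.dotProduct_mulVec_comm w v] at this
    linarith
  have := discrim_le_zero h
  rw [discrim] at this
  linarith

/-- A rank one form whose kernel contains that of a positive semidefinite form is dominated by
a multiple of it. -/
theorem Matrix.IsSymm.exists_mul_sq_le {n : Type*} [Fintype n] [DecidableEq n]
    {M : Matrix n n ℝ} (hM : M.IsSymm) (hpos : ∀ v, 0 ≤ v ⬝ᵥ M *ᵥ v) {u : n → ℝ}
    (hu : ∀ w, M *ᵥ w = 0 → u ⬝ᵥ w = 0) :
    ∃ t : ℝ, 0 < t ∧ ∀ v, t * (u ⬝ᵥ v) ^ 2 ≤ v ⬝ᵥ M *ᵥ v := by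
  obtain ⟨y, rfl⟩ := hM.exists_mulVec_eq hu
  have hy := hpos y
  refine ⟨(y ⬝ᵥ M *ᵥ y + 1)⁻¹, by positivity, fun v => ?_⟩
  rw [inv_mul_le_iff₀ (by positivity), dotProduct_comm]
  have := hM.sq_dotProduct_mulVec_le hpos v y
  nlinarith [hpos v]

theorem Matrix.insertNth_zero_dotProduct_mulVec {n : ℕ} (B : Matrix (Fin (n + 1)) (Fin (n + 1)) ℝ)
    (i : Fin (n + 1)) (v w : Fin n → ℝ) :
    (i.insertNth 0 v : Fin (n + 1) → ℝ) ⬝ᵥ B *ᵥ (i.insertNth 0 w : Fin (n + 1) → ℝ) =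
      v ⬝ᵥ B.submatrix i.succAbove i.succAbove *ᵥ w := by
  simp [dotProduct, mulVec, Fin.sum_univ_succAbove _ i]

theorem mul_sq_le_of_orthogonal_isotropic {n : ℕ} {B : Matrix (Fin (n + 1)) (Fin (n + 1)) ℝ}
    (hB : B.IsSymm) (i : Fin (n + 1))
    (hpos : ∀ v : Fin (n + 1) → ℝ, v i = 0 → 0 ≤ v ⬝ᵥ B *ᵥ v) {u : Fin (n + 1) → ℝ}
    (hu : ∀ w : Fin (n + 1) → ℝ, w i = 0 → w ⬝ᵥ B *ᵥ w = 0 → u ⬝ᵥ w = 0) :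
    ∃ t : ℝ, 0 < t ∧ ∀ v : Fin (n + 1) → ℝ, v i = 0 → t * (u ⬝ᵥ v) ^ 2 ≤ v ⬝ᵥ B *ᵥ v := by
  have hdot : ∀ v : Fin n → ℝ, u ⬝ᵥ (i.insertNth 0 v : Fin (n + 1) → ℝ) =
      (fun j => u (i.succAbove j)) ⬝ᵥ v := by
    intro v
    simp [dotProduct, Fin.sum_univ_succAbove _ i]
  obtain ⟨t, ht, h⟩ := (hB.submatrix i.succAbove).exists_mul_sq_le
    (u := fun j => u (i.succAbove j))
    (fun v => by
      rw [← insertNth_zero_dotProduct_mulVec]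
      exact hpos _ (by simp))
    (fun w hw => by
      rw [← hdot]
      refine hu _ (by simp) ?_
      rw [insertNth_zero_dotProduct_mulVec, hw, dotProduct_zero])
  refine ⟨t, ht, fun v hv => ?_⟩
  have hv' : v = (i.insertNth 0 (i.removeNth v) : Fin (n + 1) → ℝ) := by
    rw [← hv, Fin.insertNth_self_removeNth]
  rw [hv', hdot, insertNth_zero_dotProduct_mulVec]
  exact h _

section Extreme

variable {B : Matrix (Fin 4) (Fin 4) ℝ}

theorem sq_apply_le_of_mem_dualCone (hmem : B ∈ dualCone (FW 4 3)) (i j : Fin 4) :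
    B i j ^ 2 ≤ B i i * B j j := by
  obtain ⟨hs, hpos⟩ := (mem_dualCone_FW_four_three_iff B).1 hmem
  have hk : ∀ i j : Fin 4, ∃ k, k ≠ i ∧ k ≠ j := by decide
  obtain ⟨k, hki, hkj⟩ := hk i j
  have h : ∀ x : ℝ, 0 ≤ B i i * (x * x) + (2 * B i j) * x + B j j := by
    intro x
    have := hpos (x • Pi.single i 1 + Pi.single j 1) ⟨k, by simp [hki, hkj]⟩
    simp only [mulVec_add, mulVec_smul, dotProduct_add, add_dotProduct, dotProduct_smul,
      smul_dotProduct, smul_eq_mul, mulVec_single_one, single_one_dotProduct, col_apply,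
      hs.apply i j] at this
    linarith
  have := discrim_le_zero h
  rw [discrim] at this
  linarith

theorem diag_pos_of_mem_dualCone (hmem : B ∈ dualCone (FW 4 3)) (hB : ¬ B.PosSemidef)
    (i : Fin 4) : 0 < B i i := by
  obtain ⟨hs, hpos⟩ := (mem_dualCone_FW_four_three_iff B).1 hmem
  have hnonneg : 0 ≤ B i i := by
    obtain ⟨j, hj⟩ : ∃ j : Fin 4, j ≠ i := exists_ne i
    have := hpos (Pi.single i 1) ⟨j, by simp [hj]⟩
    simpa using this
  refine hnonneg.lt_of_ne fun h0 => hB ?_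
  have hrow : ∀ j, B i j = 0 := by
    intro j
    have := sq_apply_le_of_mem_dualCone hmem i j
    rw [← h0, zero_mul] at this
    exact pow_eq_zero_iff two_ne_zero |>.1 (le_antisymm this (sq_nonneg _))
  have hcol : B *ᵥ Pi.single i 1 = 0 := by
    ext j
    rw [mulVec_single_one, col_apply, hs.apply, hrow, Pi.zero_apply]
  refine PosSemidef.of_dotProduct_mulVec_nonneg ((conjTranspose_eq_transpose_of_trivial B).trans hs) fun v => ?_
  have := hpos (v - v i • Pi.single i 1) ⟨i, by simp⟩
  rw [mulVec_sub, mulVec_smul, hcol, smul_zero, sub_zero, sub_dotProduct, smul_dotProduct,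
    hs.dotProduct_mulVec_comm (Pi.single i 1), hcol] at this
  simpa using this

/-- The vectors with a vanishing coordinate that are isotropic for a non-psd extreme matrix
span the whole space. -/
theorem span_isotropic_eq_top (hB : ¬ B.PosSemidef)
    (hext : SpansExtremeRay (dualCone (FW 4 3)) B) :
    Submodule.span ℝ {w : Fin 4 → ℝ | (∃ i, w i = 0) ∧ w ⬝ᵥ B *ᵥ w = 0} = ⊤ := by
  have hmem : B ∈ dualCone (FW 4 3) := hext.2.1 ⟨1, by simp⟩
  have hdiag := diag_pos_of_mem_dualCone hmem hB
  obtain ⟨hs, hpos⟩ := (mem_dualCone_FW_four_three_iff B).1 hmem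
  by_contra hne
  obtain ⟨f, hf0, hf⟩ := Submodule.exists_le_ker_of_lt_top _ (lt_top_iff_ne_top.2 hne)
  obtain ⟨u, rfl⟩ := (dotProductEquiv ℝ (Fin 4)).surjective f
  have hu0 : u ≠ 0 := by
    rintro rfl
    exact hf0 (map_zero _)
  have hu : ∀ w : Fin 4 → ℝ, (∃ i, w i = 0) → w ⬝ᵥ B *ᵥ w = 0 → u ⬝ᵥ w = 0 :=
    fun w h1 h2 => by simpa using hf (Submodule.subset_span ⟨h1, h2⟩)
  choose t ht htle using fun i => mul_sq_le_of_orthogonal_isotropic hs i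
    (fun v hv => hpos v ⟨i, hv⟩) (fun w hw => hu w ⟨i, hw⟩)
  obtain ⟨j, hj⟩ := Finite.exists_min t
  have hform : ∀ v, v ⬝ᵥ (t j • vecMulVec u u) *ᵥ v = t j * (u ⬝ᵥ v) ^ 2 := by
    intro v
    rw [smul_mulVec, dotProduct_smul, vecMulVec_mulVec, op_smul_eq_smul, dotProduct_smul,
      dotProduct_comm v u]
    simp only [smul_eq_mul]
    ring
  have hsE : (t j • vecMulVec u u).IsSymm := by
    rw [IsSymm, transpose_smul, transpose_vecMulVec]
  obtain ⟨s, hsB⟩ := hext.exists_eq_smul (E := t j • vecMulVec u u)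
    ((mem_dualCone_FW_four_three_iff _).2 ⟨hs.add hsE, fun v hv => by
      rw [add_mulVec, dotProduct_add, hform]
      have := hpos v hv
      have := (ht j).le
      positivity⟩)
    ((mem_dualCone_FW_four_three_iff _).2 ⟨hs.sub hsE, fun v ⟨i, hv⟩ => by
      rw [sub_mulVec, dotProduct_sub, hform]
      have h1 := htle i v hv
      have h2 := mul_le_mul_of_nonneg_right (hj i) (sq_nonneg (u ⬝ᵥ v))
      linarith⟩)
  obtain ⟨k, hk⟩ := Function.ne_iff.1 hu0
  have hspos : 0 < s := by
    have h := congrFun (congrFun hsB k) k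
    simp only [Matrix.smul_apply, vecMulVec_apply, smul_eq_mul] at h
    have h1 : 0 < t j * (u k * u k) := mul_pos (ht j) (mul_self_pos.2 hk)
    rw [h] at h1
    exact pos_of_mul_pos_left h1 (hdiag k).le
  refine hB (PosSemidef.of_dotProduct_mulVec_nonneg ((conjTranspose_eq_transpose_of_trivial B).trans hs) fun v => ?_)
  have h := hform v
  rw [hsB, smul_mulVec, dotProduct_smul, smul_eq_mul] at h
  have h1 : 0 ≤ t j * (u ⬝ᵥ v) ^ 2 := mul_nonneg (ht j).le (sq_nonneg _)
  rw [← h] at h1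
  simpa using nonneg_of_mul_nonneg_right h1 hspos

theorem mulVec_apply_eq_zero_of_isotropic (hmem : B ∈ dualCone (FW 4 3)) {w : Fin 4 → ℝ}
    {i j : Fin 4} (hw : w i = 0) (hq : w ⬝ᵥ B *ᵥ w = 0) (hij : j ≠ i) : (B *ᵥ w) j = 0 := by
  obtain ⟨hs, hpos⟩ := (mem_dualCone_FW_four_three_iff B).1 hmem
  have h : ∀ x : ℝ, 0 ≤ 0 * (x * x) + (2 * (B *ᵥ w) j) * x + B j j := by
    intro x
    have := hpos (x • w + Pi.single j 1) ⟨i, by simp [hw, hij.symm]⟩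
    rw [mulVec_add, mulVec_smul, dotProduct_add, add_dotProduct, add_dotProduct,
      dotProduct_smul, smul_dotProduct, smul_dotProduct, dotProduct_smul,
      hs.dotProduct_mulVec_comm w (Pi.single j 1), hq] at this
    simp only [smul_eq_mul, mulVec_single_one, single_one_dotProduct, col_apply] at this
    linarith
  have := discrim_le_zero h
  rw [discrim] at this
  nlinarith

theorem exists_inverse_diag_eq_zero (hB : ¬ B.PosSemidef)
    (hext : SpansExtremeRay (dualCone (FW 4 3)) B) :
    ∃ C : Matrix (Fin 4) (Fin 4) ℝ, B * C = 1 ∧ ∀ i, C i i = 0 := by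
  have hmem : B ∈ dualCone (FW 4 3) := hext.2.1 ⟨1, by simp⟩
  have hcol : ∀ i, ∃ w : Fin 4 → ℝ, w i = 0 ∧ B *ᵥ w = Pi.single i 1 := by
    intro i
    by_contra! hne
    have hle : Submodule.span ℝ {w : Fin 4 → ℝ | (∃ i, w i = 0) ∧ w ⬝ᵥ B *ᵥ w = 0} ≤
        LinearMap.ker (LinearMap.proj i ∘ₗ B.mulVecLin) := by
      refine Submodule.span_le.2 ?_
      rintro w ⟨⟨k, hk⟩, hq⟩
      simp only [SetLike.mem_coe, LinearMap.mem_ker, LinearMap.comp_apply, mulVecLin_apply,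
        LinearMap.proj_apply]
      by_cases hki : k = i
      · subst hki
        by_contra hα
        refine hne (((B *ᵥ w) k)⁻¹ • w) (by simp [hk]) ?_
        ext j
        rw [mulVec_smul, Pi.smul_apply, smul_eq_mul]
        by_cases hj : j = k
        · subst hj
          simp [hα]
        · simp [hj, mulVec_apply_eq_zero_of_isotropic hmem hk hq hj]
      · exact mulVec_apply_eq_zero_of_isotropic hmem hk hq (Ne.symm hki)
    rw [span_isotropic_eq_top hB hext] at hle
    have := hle (Submodule.mem_top (x := Pi.single i 1))
    simp only [LinearMap.mem_ker, LinearMap.comp_apply, mulVecLin_apply, LinearMap.proj_apply,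
      mulVec_single_one, col_apply] at this
    exact (diag_pos_of_mem_dualCone hmem hB i).ne' this
  choose w hw0 hw using hcol
  refine ⟨of fun j i => w i j, ?_, hw0⟩
  ext j i
  have := congrFun (hw i) j
  rw [one_apply, mul_apply]
  simpa [mulVec, dotProduct, Pi.single_apply] using this

end Extreme

/-- If a symmetric matrix of order 4 has unit diagonal and its inverse has zero diagonal, then
complementary entries agree up to a common sign. -/
theorem exists_sign_of_inverse_diag_eq_zero {B C : Matrix (Fin 4) (Fin 4) ℝ} (hB : B.IsSymm)
    (hdiag : ∀ i, B i i = 1) (hBC : B * C = 1) (hC : ∀ i, C i i = 0) :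
    ∃ e : ℝ, e ^ 2 = 1 ∧ B 0 1 = e * B 2 3 ∧ B 0 2 = e * B 1 3 ∧ B 0 3 = e * B 1 2 := by
  have hCs : C.IsSymm := by
    rw [← inv_eq_right_inv hBC]
    exact hB.inv
  have hCB : C * B = 1 := mul_eq_one_comm.1 hBC
  have hadj : adjugate C = C.det • B := by
    calc adjugate C = adjugate C * (C * B) := by rw [hCB, Matrix.mul_one]
      _ = C.det • B := by rw [← Matrix.mul_assoc, adjugate_mul, smul_mul, Matrix.one_mul]
  have hdet : C.det ≠ 0 := by
    intro h
    have := congrArg det hCB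
    rw [det_mul, h, zero_mul, det_one] at this
    exact zero_ne_one this
  have hent : ∀ i j : Fin 4, (-1) ^ (j + i : ℕ) * (C.submatrix j.succAbove i.succAbove).det =
      C.det * B i j := by
    intro i j
    rw [← adjugate_fin_succ_eq_det_submatrix, hadj, Matrix.smul_apply, smul_eq_mul]
  generalize C.det = Δ at hdet hent
  have s10 := hCs.apply 0 1
  have s20 := hCs.apply 0 2
  have s30 := hCs.apply 0 3
  have s21 := hCs.apply 1 2
  have s31 := hCs.apply 1 3
  have s32 := hCs.apply 2 3
  have h00 := hent 0 0
  have h11 := hent 1 1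
  have h22 := hent 2 2
  have h33 := hent 3 3
  have h01 := hent 0 1
  have h02 := hent 0 2
  have h03 := hent 0 3
  have h12 := hent 1 2
  have h13 := hent 1 3
  have h23 := hent 2 3
  simp [det_fin_three, Fin.succAbove, hC, hdiag, s10, s20, s30, s21, s31, s32, Fin.lt_def]
    at h00 h11 h22 h33 h01 h02 h03 h12 h13 h23
  generalize C 0 1 = p, C 0 2 = q, C 0 3 = r, C 1 2 = r', C 1 3 = q', C 2 3 = p' at *
  have hp' : p' ≠ 0 := by rintro rfl; exact hdet (by linarith)
  have hq' : q' ≠ 0 := by rintro rfl; exact hdet (by linarith)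
  have hr : r ≠ 0 := by rintro rfl; exact hdet (by linarith)
  have hp : p ≠ 0 := by rintro rfl; exact hdet (by linarith)
  have e₁ : r' * q' = q * r := mul_left_cancel₀ hp' (by linarith)
  have e₂ : p * q' = q * p' := mul_left_cancel₀ hr (by linarith)
  have e₃ : r * q' = q * r' := mul_left_cancel₀ hp (by linarith)
  obtain ⟨e, rfl⟩ : ∃ e, q = e * q' := ⟨q / q', by field_simp⟩
  obtain rfl : r' = e * r := mul_right_cancel₀ hq' (by linarith)
  obtain rfl : p = e * p' := mul_right_cancel₀ hq' (by linarith)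
  have he : e ^ 2 = 1 := mul_left_cancel₀ (mul_ne_zero hr hq') (by linarith)
  refine ⟨e, he, mul_left_cancel₀ hdet ?_, mul_left_cancel₀ hdet ?_, mul_left_cancel₀ hdet ?_⟩
  · linear_combination e * h23 - h01 + e * p' * (r ^ 2 + q' ^ 2 - p' ^ 2) * he
  · linear_combination e * h13 - h02 + e * q' * (p' ^ 2 + r ^ 2 - q' ^ 2) * he
  · linear_combination e * h12 - h03

theorem exists_cos_eq {x y z : ℝ} (hx : x ^ 2 < 1) (hz : z ^ 2 < 1)
    (h : (y - x * z) ^ 2 = (1 - x ^ 2) * (1 - z ^ 2)) :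
    ∃ a ∈ Set.Ioo (-Real.pi) Real.pi \ {0}, ∃ c ∈ Set.Ioo (-Real.pi) Real.pi \ {0},
      Real.cos a = x ∧ Real.cos (a - c) = y ∧ Real.cos c = z := by
  have harc : ∀ {t : ℝ}, t ^ 2 < 1 → Real.arccos t ∈ Set.Ioo 0 Real.pi := by
    intro t ht
    obtain ⟨h1, h2⟩ := abs_lt.1 ((sq_lt_one_iff_abs_lt_one t).1 ht)
    exact ⟨Real.arccos_pos.2 h2, by
      refine (Real.arccos_le_pi t).lt_of_ne fun hpi => ?_
      exact h1.not_ge (Real.arccos_eq_pi.1 hpi)⟩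
  have hcos : ∀ {t : ℝ}, t ^ 2 < 1 → Real.cos (Real.arccos t) = t := by
    intro t ht
    obtain ⟨h1, h2⟩ := abs_lt.1 ((sq_lt_one_iff_abs_lt_one t).1 ht)
    exact Real.cos_arccos h1.le h2.le
  obtain ⟨ha0, haπ⟩ := harc hx
  obtain ⟨hc0, hcπ⟩ := harc hz
  have hsq : (y - x * z) ^ 2 = (√(1 - x ^ 2) * √(1 - z ^ 2)) ^ 2 := by
    rw [mul_pow, Real.sq_sqrt (by linarith), Real.sq_sqrt (by linarith), h]
  refine ⟨Real.arccos x, ⟨⟨by linarith, haπ⟩, ha0.ne'⟩, ?_⟩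
  rcases sq_eq_sq_iff_eq_or_eq_neg.1 hsq with h | h
  · refine ⟨Real.arccos z, ⟨⟨by linarith, hcπ⟩, hc0.ne'⟩, hcos hx, ?_, hcos hz⟩
    rw [Real.cos_sub, hcos hx, hcos hz, Real.sin_arccos, Real.sin_arccos]
    linarith
  · refine ⟨-Real.arccos z, ⟨⟨by linarith, by linarith⟩, (neg_neg_of_pos hc0).ne⟩, hcos hx, ?_,
      by rw [Real.cos_neg, hcos hz]⟩
    rw [sub_neg_eq_add, Real.cos_add, hcos hx, hcos hz, Real.sin_arccos, Real.sin_arccos]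
    linarith

theorem mainTheorem3 (B : Matrix (Fin 4) (Fin 4) ℝ) (hsymm : B.IsSymm) (hB : ¬ B.PosSemidef)
    (hext : SpansExtremeRay (dualCone (FW 4 3)) B) :
    ∃ a ∈ Set.Ioo (-Real.pi) Real.pi \ {0}, ∃ c ∈ Set.Ioo (-Real.pi) Real.pi \ {0},
      ∃ (σ : Equiv.Perm (Fin 4)) (d : Fin 4 → ℝ), (∀ i, d i ≠ 0) ∧
        Matrix.diagonal d * σ.permMatrix ℝ * B * (σ.permMatrix ℝ).transpose * Matrix.diagonal d =
          !![1, Real.cos a, Real.cos (a - c), Real.cos c;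
             Real.cos a, 1, Real.cos c, Real.cos (a - c);
             Real.cos (a - c), Real.cos c, 1, Real.cos a;
             Real.cos c, Real.cos (a - c), Real.cos a, 1] := by
  have hmem : B ∈ dualCone (FW 4 3) := hext.2.1 ⟨1, by simp⟩
  have hpos := diag_pos_of_mem_dualCone hmem hB
  obtain ⟨C, hBC, hC⟩ := exists_inverse_diag_eq_zero hB hext
  set s : Fin 4 → ℝ := fun i => (√(B i i))⁻¹ with hs
  have hs0 : ∀ i, s i ≠ 0 := fun i => inv_ne_zero (Real.sqrt_pos.2 (hpos i)).ne'
  have hs2 : ∀ i, s i ^ 2 * B i i = 1 := fun i => by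
    rw [hs, inv_pow, Real.sq_sqrt (hpos i).le, inv_mul_cancel₀ (hpos i).ne']
  have hss : diagonal s * diagonal s⁻¹ = (1 : Matrix (Fin 4) (Fin 4) ℝ) := by
    rw [diagonal_mul_diagonal, ← diagonal_one]
    congr 1
    ext i
    simp [hs0 i]
  set M := diagonal s * B * diagonal s with hM
  have hMapp : ∀ i j, M i j = s i * B i j * s j := fun i j => by
    rw [hM, mul_diagonal, diagonal_mul]
  have hMsymm : M.IsSymm := by
    ext i j
    rw [transpose_apply, hMapp, hMapp, hsymm.apply]
    ring
  have hMdiag : ∀ i, M i i = 1 := fun i => by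
    rw [hMapp, ← hs2 i]
    ring
  have hMsq : ∀ i j, M i j ^ 2 ≤ 1 := fun i j => by
    have h := mul_le_mul_of_nonneg_left (sq_apply_le_of_mem_dualCone hmem i j)
      (mul_nonneg (sq_nonneg (s i)) (sq_nonneg (s j)))
    calc M i j ^ 2 = s i ^ 2 * s j ^ 2 * B i j ^ 2 := by rw [hMapp]; ring
      _ ≤ s i ^ 2 * s j ^ 2 * (B i i * B j j) := h
      _ = (s i ^ 2 * B i i) * (s j ^ 2 * B j j) := by ring
      _ = 1 := by rw [hs2, hs2, one_mul]
  set N := diagonal s⁻¹ * C * diagonal s⁻¹ with hN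
  have hMN : M * N = 1 := by
    calc M * N = diagonal s * B * (diagonal s * diagonal s⁻¹) * C * diagonal s⁻¹ := by
          rw [hM, hN]; simp only [Matrix.mul_assoc]
      _ = diagonal s * (B * C) * diagonal s⁻¹ := by
          rw [hss]; simp only [Matrix.mul_assoc, Matrix.one_mul]
      _ = 1 := by rw [hBC, Matrix.mul_one, hss]
  have hNdiag : ∀ i, N i i = 0 := fun i => by
    rw [hN, mul_diagonal, diagonal_mul, hC, mul_zero, zero_mul]
  obtain ⟨e, he, h01, h02, h03⟩ := exists_sign_of_inverse_diag_eq_zero hMsymm hMdiag hMN hNdiag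
  have hdet : M.det ≠ 0 := by
    intro h
    have := congrArg det hMN
    rw [det_mul, h, zero_mul, det_one] at this
    exact zero_ne_one this
  have hminor : (M.submatrix (Fin.succAbove 0) (Fin.succAbove 0)).det = 0 := by
    have hadj : adjugate M = M.det • N := by
      calc adjugate M = adjugate M * (M * N) := by rw [hMN, Matrix.mul_one]
        _ = M.det • N := by rw [← Matrix.mul_assoc, adjugate_mul, smul_mul, Matrix.one_mul]
    have := congrFun (congrFun hadj 0) 0
    rw [adjugate_fin_succ_eq_det_submatrix, Matrix.smul_apply, hNdiag] at this
    simpa using this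
  have t10 := hMsymm.apply 0 1
  have t20 := hMsymm.apply 0 2
  have t30 := hMsymm.apply 0 3
  have t21 := hMsymm.apply 1 2
  have t31 := hMsymm.apply 1 3
  have t32 := hMsymm.apply 2 3
  have hx1 := hMsq 2 3
  have hz1 := hMsq 1 2
  rw [h01] at t10
  rw [h02] at t20
  rw [h03] at t30
  set x := M 2 3 with hx
  set y := M 1 3 with hy
  set z := M 1 2 with hz
  have hMeq : M = !![1, e * x, e * y, e * z; e * x, 1, z, y; e * y, z, 1, x; e * z, y, x, 1] := by
    ext i j
    fin_cases i <;> fin_cases j <;> simp [hMdiag, t10, t20, t30, t21, t31, t32, h01, h02, h03,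
      ← hx, ← hy, ← hz]
  have hrel : (y - x * z) ^ 2 = (1 - x ^ 2) * (1 - z ^ 2) := by
    rw [hMeq] at hminor
    simp [det_fin_three] at hminor
    linarith
  have hdet' : M.det = ((1 + x) ^ 2 - (y + z) ^ 2) * ((1 - x) ^ 2 - (y - z) ^ 2) := by
    rw [hMeq]
    simp [det_succ_row_zero, Fin.sum_univ_succ, Fin.succAbove]
    linear_combination (-(x ^ 2 + y ^ 2 + z ^ 2) + 2 * x * y * z +
      (4 * x * y * z - 2 * x ^ 2 * z ^ 2 - 2 * x ^ 2 * y ^ 2 - 2 * y ^ 2 * z ^ 2 + x ^ 4 + y ^ 4 +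
        z ^ 4)) * he
  have hx2 : x ^ 2 < 1 := by
    refine hx1.lt_of_ne fun h => hdet ?_
    have hyz : y - x * z = 0 := by
      rw [h, sub_self, zero_mul] at hrel
      exact pow_eq_zero_iff two_ne_zero |>.1 hrel
    have hy' : y = x * z := by linarith
    rw [hdet', hy']
    linear_combination (x ^ 2 - 1 + z ^ 4 * (x ^ 2 - 1) - 2 * z ^ 2 * (x ^ 2 - 1)) * h
  have hz2 : z ^ 2 < 1 := by
    refine hz1.lt_of_ne fun h => hdet ?_
    have hyz : y - x * z = 0 := by
      rw [h, sub_self, mul_zero] at hrel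
      exact pow_eq_zero_iff two_ne_zero |>.1 hrel
    have hy' : y = x * z := by linarith
    rw [hdet', hy']
    linear_combination ((x ^ 2 - 1) ^ 2 * (z ^ 2 - 1)) * h
  obtain ⟨a, ha, c, hc, hax, hay, haz⟩ := exists_cos_eq hx2 hz2 hrel
  have he0 : e ≠ 0 := by
    rintro rfl
    norm_num at he
  refine ⟨a, ha, c, hc, 1, ![e * s 0, s 1, s 2, s 3], ?_, ?_⟩
  · intro i
    fin_cases i <;> simp [he0, hs0]
  · have hD : diagonal ![e * s 0, s 1, s 2, s 3] =
        diagonal ![e, 1, 1, 1] * diagonal s := by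
      rw [diagonal_mul_diagonal]
      congr 1
      ext i
      fin_cases i <;> simp
    have hD' : diagonal ![e * s 0, s 1, s 2, s 3] =
        diagonal s * diagonal ![e, 1, 1, 1] := by
      rw [hD, diagonal_mul_diagonal, diagonal_mul_diagonal]
      simp only [mul_comm]
    have hprod : diagonal ![e * s 0, s 1, s 2, s 3] * B * diagonal ![e * s 0, s 1, s 2, s 3] =
        diagonal ![e, 1, 1, 1] * M * diagonal ![e, 1, 1, 1] := by
      nth_rw 1 [hD]
      rw [hD', hM]
      simp only [Matrix.mul_assoc]
    have hcancel : ∀ t : ℝ, e * (e * t) = t := fun t => by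
      rw [← mul_assoc, ← sq, he, one_mul]
    rw [permMatrix_one, transpose_one, Matrix.mul_one, Matrix.mul_one, hprod, hMeq,
      hax, hay, haz]
    ext i j
    rw [mul_diagonal, diagonal_mul]
    fin_cases i <;> fin_cases j <;> simp [hcancel, mul_right_comm e, ← sq, he, mul_comm]
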